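/- All $G$-sets are non-empty. For functions $f,g\colon\mathbb N\to\mathbb R_{\ge 0}$ write $f\preccurlyeq g$ (equivalently $g\succcurlyeq f$) if there is a constant $C>0$ with $f(n)\le C\,g(Cn)$ for all $n$. For a group $G$ with finite generating set $S$, let $|\cdot|_S$ be the word length; for a $G$-set $X$, put $\mathrm{vol}_{G,X}(n)=\max_{x\in X}|\{gx : g\in G,\ |g|_S\le n\}|$, the maximal cardinality of a ball of radius $n$ in the Schreier graph of the action; for a subset $L\subseteq G$, put $\mathrm{vol}_{(G,L)}(n)=\max_{h\in L}|\{g\in L : |gh^{-1}|_S\le n\}|$, the relative growth of $L$ in $G$. A finitely generated group $G$ has a Schreier growth gap $f(n)$ if $\mathrm{vol}_{G,X}(n)\succcurlyeq f(n)$ for every faithful $G$-set $X$ (and every finite generating set; the choice does not matter). A subset $\mathcal L\subseteq G$ is non-foldable if for every faithful $G$-set $X$ and every finite $\Sigma\subseteq\mathcal L$ there is $x\in X$ such that $g\mapsto gx$ is injective on $\Sigma$. Given a homomorphism $\pi\colon G\to Q$, a subset $\mathcal L\subseteq G$ is a lift of $L\subseteq Q$ if $\pi$ restricts to a bijection from $\mathcal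 L$ onto $L$. Let $F_d$ be the free group of rank $d$, with derived series $F_d^{(0)}=F_d$, $F_d^{(i+1)}=[F_d^{(i)},F_d^{(i)}]$. \textbf{Theorem.} (1) For all $d\ge 2$ and $\ell\ge 3$, the free solvable group $F_d/F_d^{(\ell)}$ of rank $d$ and length $\ell$ has a Schreier growth gap $\exp(n)$. (2) Let $d\ge 0$, let $N$ be a normal subgroup of $F_d$, $N'=[N,N]$, $G=F_d/N'$ and $Q=F_d/N$, and let $L$ be a torsion-free abelian subgroup of $Q$. Then (i) every lift $\mathcal L\subseteq G$ of $L$ along the canonical projection $G\to Q$ is a non-foldable subset of $G$; (ii) $\mathrm{vol}_{G,X}(n)\succcurlyeq \mathrm{vol}_{(Q,L)}(n)$ for every faithful $G$-set $X$. -/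

import Mathlib

open scoped Pointwise

universe u v w

namespace SchreierGrowth

/-- The ball of radius `n` around the identity for the word metric of `S`: the elements of `G` that
are products of at most `n` elements of `S ∪ S⁻¹`. -/
def wordBall {G : Type u} [Group G] (S : Set G) (n : ℕ) : Set G :=
  (insert 1 (S ∪ S⁻¹)) ^ n

/-- `S` is a finite generating subset of `G`. -/
def IsFiniteGenSet {G : Type u} [Group G] (S : Set G) : Prop :=
  S.Finite ∧ Subgroup.closure S = ⊤

/-- The ball of radius `n` around `x` in the Schreier graph of the action of `G` on `X`, whose edges
join `x` to `s • x` for `s ∈ S`. -/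
def schreierBall {G : Type u} [Group G] (S : Set G) (X : Type v) [MulAction G X] (n : ℕ) (x : X) :
    Set X :=
  (fun g : G => g • x) '' wordBall S n

/-- The growth of the action of `G` on `X`: the largest cardinality of a ball of radius `n` in the
Schreier graph. The supremum is that of a bounded set when `S` is finite, see `bddAbove_vol`. -/
noncomputable def vol {G : Type u} [Group G] (S : Set G) (X : Type v) [MulAction G X] (n : ℕ) : ℕ :=
  ⨆ x : X, (schreierBall S X n x).ncard

/-- The relative growth of a subset `L` of `G`: the largest cardinality of a ball of radius `n` in
`L` with the restriction of the right-invariant word metric of `S`. The supremum is that of a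
bounded set when `S` is finite, see `bddAbove_relVol`. -/
noncomputable def relVol {G : Type u} [Group G] (S : Set G) (L : Set G) (n : ℕ) : ℕ :=
  ⨆ h : L, {g : G | g ∈ L ∧ g * (h : G)⁻¹ ∈ wordBall S n}.ncard

theorem wordBall_finite {G : Type u} [Group G] {S : Set G} (hS : S.Finite) (n : ℕ) :
    (wordBall S n).Finite := by
  have h : (insert 1 (S ∪ S⁻¹)).Finite := (hS.union hS.inv).insert 1
  unfold wordBall
  induction n with
  | zero => simp
  | succ k ih => rw [pow_succ]; exact ih.mul h

theorem bddAbove_vol {G : Type u} [Group G] {S : Set G} (hS : S.Finite) (X : Type v)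
    [MulAction G X] (n : ℕ) :
    BddAbove (Set.range fun x : X => (schreierBall S X n x).ncard) := by
  refine ⟨(wordBall S n).ncard, ?_⟩
  rintro _ ⟨x, rfl⟩
  exact Set.ncard_image_le (wordBall_finite hS n)

theorem bddAbove_relVol {G : Type u} [Group G] {S : Set G} (hS : S.Finite) (L : Set G) (n : ℕ) :
    BddAbove (Set.range fun h : L => {g : G | g ∈ L ∧ g * (h : G)⁻¹ ∈ wordBall S n}.ncard) := by
  refine ⟨(wordBall S n).ncard, ?_⟩
  rintro _ ⟨h, rfl⟩
  exact Set.ncard_le_ncard_of_injOn (fun g => g * (h : G)⁻¹) (fun g hg => hg.2)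
    (fun a _ b _ hab => mul_right_cancel hab) (wordBall_finite hS n)

/-- `f ≼ g`: there is a constant `C > 0` such that `f n ≤ C * g (C * n)` for all `n`. -/
def GrowthLE (f g : ℕ → ℝ) : Prop :=
  ∃ C : ℕ, 0 < C ∧ ∀ n : ℕ, f n ≤ C * g (C * n)

/-- The finitely generated group `G` has a Schreier growth gap `f`: the growth of every faithful
(non-empty) `G`-set dominates `f`, with respect to any finite generating subset. -/
def HasSchreierGrowthGap (G : Type u) [Group G] (f : ℕ → ℝ) : Prop :=
  Group.FG G ∧
    ∀ (X : Type v) [MulAction G X] [FaithfulSMul G X] [Nonempty X] (S : Set G),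
      IsFiniteGenSet S → GrowthLE f (fun n => (vol S X n : ℝ))

/-- `L` is non-folded in the `G`-set `X`: every finite subset of `L` is mapped injectively into `X`
by some orbital map. -/
def IsNonFoldedIn {G : Type u} [Group G] (L : Set G) (X : Type v) [MulAction G X] : Prop :=
  ∀ F : Finset G, (F : Set G) ⊆ L → ∃ x : X, Set.InjOn (fun g : G => g • x) (F : Set G)

/-- `L` is non-foldable: it is non-folded in every faithful (non-empty) `G`-set. -/
def IsNonFoldable {G : Type u} [Group G] (L : Set G) : Prop :=
  ∀ (X : Type v) [MulAction G X] [FaithfulSMul G X] [Nonempty X], IsNonFoldedIn L X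

/-- `L'` is a lift of `L` along `π`: it consists of exactly one preimage of every element of `L`. -/
def IsLift {G : Type u} {Q : Type w} [Group G] [Group Q] (π : G →* Q) (L' : Set G) (L : Set Q) :
    Prop :=
  Set.BijOn π L' L

/-- The subgroup `L` is abelian and torsion-free. -/
def IsTorsionFreeAbelian {Q : Type u} [Group Q] (L : Subgroup Q) : Prop :=
  (∀ a ∈ L, ∀ b ∈ L, a * b = b * a) ∧ ∀ a ∈ L, IsOfFinOrder a → a = 1

/-- The Higman type extension `F_d / N'` defined by a normal subgroup `N` of the free group `F_d`,
where `N' = [N, N]`. -/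
abbrev HigmanExtension (d : ℕ) (N : Subgroup (FreeGroup (Fin d))) [N.Normal] : Type :=
  FreeGroup (Fin d) ⧸ ⁅N, N⁆

/-- The canonical projection `F_d / N' → F_d / N`. -/
def HigmanExtension.proj (d : ℕ) (N : Subgroup (FreeGroup (Fin d))) [N.Normal] :
    HigmanExtension d N →* FreeGroup (Fin d) ⧸ N :=
  QuotientGroup.map ⁅N, N⁆ N (MonoidHom.id _) (Subgroup.commutator_le_left N N)

/-- The free solvable group of rank `d` and length `l`, that is `F_d / F_d^(l)`. -/
abbrev FreeSolvableGroup (d l : ℕ) : Type :=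
  FreeGroup (Fin d) ⧸ derivedSeries (FreeGroup (Fin d)) l

end SchreierGrowth

/-! The Fox derivative embeds N/N' into a free ℤ[Q]-module (Magnus). So A = N/N' is torsion-free,
and if g has infinite order in Q, then a ↦ [g,a] is injective on A: a finitely supported vector is
not invariant under an infinite cyclic group of translations.

If a lift of L were folded in X, the quotients a⁻¹b of distinct elements of some finite subset would
form a finite set Γ, of infinite order in Q, whose fixed point sets cover X. Conjugating by A and
applying B. H. Neumann's lemma on coset covers (`exists_commHom_pow_mem_stabilizer`), the stabilizer
of each x contains [g, a^k] for some g ∈ Γ and all a ∈ A, where k = |Γ|!. The maps [g,·] commute, so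
composing them all sends a^k into every stabilizer, hence to 1 by faithfulness. Injectivity then
gives A = 1, so N = 1 by freeness; there, abelian subgroups of F_d are cyclic and a common power
gives the contradiction. Lifting balls of L to short elements yields the growth bound.

For free solvable groups, take N = M' with M a derived subgroup and L = M/M'. Lamplighter-like
words, separated by Fox derivatives, show that L has exponential relative growth. -/

namespace SchreierGrowth

/-! ### Fox calculus. -/

section FoxDerivative

variable {α : Type u} {Q : Type w} [Group Q]

/-- The action of `q` by left translation on the free `ℤ[Q]`-module with basis `α`. -/
noncomputable def translate (q : Q) : (Q × α →₀ ℤ) ≃+ (Q × α →₀ ℤ) :=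
  Finsupp.domCongr ((Equiv.mulLeft q).prodCongr (Equiv.refl α))

theorem translate_apply (q : Q) (v : Q × α →₀ ℤ) (p : Q × α) :
    translate q v p = v (q⁻¹ * p.1, p.2) := rfl

theorem translate_mul (q r : Q) (v : Q × α →₀ ℤ) :
    translate (q * r) v = translate q (translate r v) := by
  ext p
  simp [translate_apply, mul_assoc]

theorem translate_one (v : Q × α →₀ ℤ) : translate 1 v = v := by
  ext p
  simp [translate_apply]

theorem translate_single (q : Q) (p : Q × α) (n : ℤ) :
    translate q (Finsupp.single p n) = Finsupp.single (q * p.1, p.2) n := by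
  simp [translate, Finsupp.domCongr_apply, Finsupp.equivMapDomain_single, Prod.map]

/-- The affine action of the free group on the free `ℤ[Q]`-module whose linear part is given by
`π` and whose translation part is the total Fox derivative. -/
noncomputable def foxAction (π : FreeGroup α →* Q) :
    FreeGroup α →* Equiv.Perm (Q × α →₀ ℤ) :=
  FreeGroup.lift fun i =>
    (translate (π (FreeGroup.of i))).toEquiv.trans (Equiv.addLeft (Finsupp.single (1, i) 1))

/-- The total Fox derivative of an element of the free group, with coefficients in `ℤ[Q]`. -/
noncomputable def fox (π : FreeGroup α →* Q) (w : FreeGroup α) : Q × α →₀ ℤ :=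
  foxAction π w 0

/-- With the derivative defined as the orbit of 0 under an affine action, the product rule is just
composition of affine maps. -/
theorem foxAction_apply (π : FreeGroup α →* Q) (w : FreeGroup α) :
    ∀ v, foxAction π w v = fox π w + translate (π w) v := by
  induction w using FreeGroup.induction_on with
  | C1 => intro v; simp [fox, translate_one]
  | of i => intro v; simp [fox, foxAction]
  | inv_of i ih =>
    have key : ∀ v, foxAction π (FreeGroup.of i)⁻¹ v =
        translate (π (FreeGroup.of i))⁻¹ (v - fox π (FreeGroup.of i)) := by
      intro v
      rw [map_inv, Equiv.Perm.inv_eq_iff_eq, ih, ← translate_mul]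
      simp [translate_one]
    intro v
    rw [fox, key, key, ← map_inv, ← map_add]
    congr 1
    abel
  | mul x y hx hy =>
    intro v
    rw [fox, map_mul, map_mul, Equiv.Perm.mul_apply, Equiv.Perm.mul_apply, hx, hx, hy, hy,
      translate_mul, map_add, map_add, map_zero, map_zero]
    abel

theorem fox_mul (π : FreeGroup α →* Q) (x y : FreeGroup α) :
    fox π (x * y) = fox π x + translate (π x) (fox π y) := by
  rw [← foxAction_apply, fox, map_mul, Equiv.Perm.mul_apply, fox]

@[simp]
theorem fox_one (π : FreeGroup α →* Q) : fox π 1 = 0 := by simp [fox]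

theorem fox_of (π : FreeGroup α →* Q) (i : α) :
    fox π (FreeGroup.of i) = Finsupp.single (1, i) 1 := by simp [fox, foxAction]

theorem fox_inv (π : FreeGroup α →* Q) (x : FreeGroup α) :
    fox π x⁻¹ = - translate (π x)⁻¹ (fox π x) := by
  have h := fox_mul π x⁻¹ x
  rw [inv_mul_cancel, fox_one, map_inv] at h
  exact eq_neg_of_add_eq_zero_left h.symm

theorem fox_mul_of_mem_ker (π : FreeGroup α →* Q) {x : FreeGroup α} (hx : π x = 1)
    (y : FreeGroup α) : fox π (x * y) = fox π x + fox π y := by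
  rw [fox_mul, hx, translate_one]

theorem fox_conj (π : FreeGroup α →* Q) (g : FreeGroup α) {x : FreeGroup α} (hx : π x = 1) :
    fox π (g * x * g⁻¹) = translate (π g) (fox π x) := by
  rw [fox_mul, fox_mul, fox_inv, map_neg, ← translate_mul, map_mul, hx, mul_one, mul_inv_cancel,
    translate_one]
  abel

/-- The Fox derivative restricted to the kernel of the projection, as a homomorphism. -/
noncomputable def foxHom (π : FreeGroup α →* Q) :
    π.ker →* Multiplicative (Q × α →₀ ℤ) where
  toFun x := Multiplicative.ofAdd (fox π x)
  map_one' := by simp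
  map_mul' x y := by
    rw [Subgroup.coe_mul, fox_mul_of_mem_ker π x.2]
    rfl

theorem fox_pow (π : FreeGroup α →* Q) {x : FreeGroup α} (hx : π x = 1) (m : ℕ) :
    fox π (x ^ m) = m • fox π x :=
  map_pow (foxHom π) ⟨x, hx⟩ m

theorem fox_eq_zero_of_mem (π : FreeGroup α →* Q) {x : FreeGroup α} (hx : x ∈ ⁅π.ker, π.ker⁆) :
    fox π x = 0 := by
  rw [← Subgroup.map_subtype_commutator] at hx
  obtain ⟨y, hy, rfl⟩ := hx
  exact Abelianization.commutator_subset_ker (foxHom π) hy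

/-- The points t⁻ʲp are distinct and the support is finite, so a last support point along this ray
exists. It plays the role of a leading term. -/
theorem exists_extremal_of_ne_zero {v : Q × α →₀ ℤ} (hv : v ≠ 0) {t : Q}
    (ht : ¬ IsOfFinOrder t) :
    ∃ p : Q × α, v p ≠ 0 ∧ ∀ j : ℕ, 0 < j → v ((t ^ j)⁻¹ * p.1, p.2) = 0 := by
  obtain ⟨p, hp⟩ := Finsupp.ne_iff.1 hv
  have hinj : Function.Injective fun j : ℕ => ((t ^ j)⁻¹ * p.1, p.2) := by
    intro i j hij
    apply injective_pow_iff_not_isOfFinOrder.2 ht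
    simpa using hij
  have hfin : {j : ℕ | v ((t ^ j)⁻¹ * p.1, p.2) ≠ 0}.Finite :=
    (v.hasFiniteSupport.preimage hinj.injOn).subset fun j hj => hj
  obtain ⟨m, hm, hmax⟩ := hfin.exists_maximal ⟨0, by simpa using hp⟩
  refine ⟨_, hm, fun j hj => ?_⟩
  by_contra hne
  have := hmax (y := m + j) (by simpa [pow_add, mul_assoc, pow_mul_comm] using hne) (by simp)
  simp at this
  omega

/-! ### The Magnus embedding of N/N'. -/

variable (N : Subgroup (FreeGroup α)) [N.Normal]

theorem out_mul_mul_out_inv_mem (w : FreeGroup α) (q : FreeGroup α ⧸ N) :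
    q.out * w * (q * (w : FreeGroup α ⧸ N)).out⁻¹ ∈ N := by
  rw [← QuotientGroup.eq_one_iff]
  simp

/-- The homomorphism from the free `ℤ[F/N]`-module to the abelianization of `N` that sends an edge
of the Cayley graph of `F/N` to the corresponding Schreier generator. -/
noncomputable def schreierHom :
    ((FreeGroup α ⧸ N) × α →₀ ℤ) →+ Additive (Abelianization N) :=
  Finsupp.liftAddHom fun p => zmultiplesHom _ (Additive.ofMul (Abelianization.of
    ⟨_, out_mul_mul_out_inv_mem N (FreeGroup.of p.2) p.1⟩))

/-- The derivative records the edges of the path labelled w from q; the product of their Schreier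
generators telescopes. -/
theorem schreierHom_fox (w : FreeGroup α) (q : FreeGroup α ⧸ N) :
    schreierHom N (translate q (fox (QuotientGroup.mk' N) w)) =
      Additive.ofMul (Abelianization.of ⟨_, out_mul_mul_out_inv_mem N w q⟩) := by
  induction w using FreeGroup.induction_on generalizing q with
  | C1 =>
    rw [fox_one, map_zero, map_zero, ← ofMul_one, ← map_one Abelianization.of]
    congr 2
    ext1
    simp
  | of i => simp [fox_of, translate_single, schreierHom]
  | inv_of i ih =>
    rw [fox_inv, map_neg, map_neg, ← translate_mul, ih, ← ofMul_inv, ← map_inv]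
    congr 2
    ext1
    simp [mul_assoc]
  | mul x y hx hy =>
    rw [fox_mul, map_add, map_add, ← translate_mul, hx, hy, ← ofMul_mul, ← map_mul]
    congr 2
    ext1
    simp [mul_assoc]

theorem mem_commutator_of_fox_eq_zero {x : FreeGroup α} (hx : x ∈ N)
    (h : fox (QuotientGroup.mk' N) x = 0) : x ∈ ⁅N, N⁆ := by
  have h1 := schreierHom_fox N x 1
  rw [h, map_zero, map_zero, ← ofMul_one, Additive.ofMul.apply_eq_iff_eq] at h1
  -- The representative of the trivial coset need not be 1, but conjugating by an element of N does
  -- not change the class in N/N'.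
  have hs : (1 : FreeGroup α ⧸ N).out ∈ N := by
    rw [← QuotientGroup.eq_one_iff]; simp
  have h2 : (⟨_, out_mul_mul_out_inv_mem N x 1⟩ : N) =
      ⟨_, hs⟩ * ⟨x, hx⟩ * ⟨_, hs⟩⁻¹ := by
    ext1
    simp [(QuotientGroup.eq_one_iff x).2 hx]
  rw [h2, map_mul, map_mul, map_inv, mul_comm, inv_mul_cancel_left, eq_comm,
    ← MonoidHom.mem_ker, Abelianization.ker_of] at h1
  rw [← Subgroup.map_subtype_commutator]
  exact ⟨_, h1, rfl⟩

theorem mem_commutator_iff_fox {x : FreeGroup α} (hx : x ∈ N) :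
    x ∈ ⁅N, N⁆ ↔ fox (QuotientGroup.mk' N) x = 0 := by
  refine ⟨fun h => fox_eq_zero_of_mem _ ?_, mem_commutator_of_fox_eq_zero N hx⟩
  rwa [QuotientGroup.ker_mk']

theorem mem_commutator_of_pow_mem {x : FreeGroup α} (hx : x ∈ N) {m : ℕ} (hm : m ≠ 0)
    (h : x ^ m ∈ ⁅N, N⁆) : x ∈ ⁅N, N⁆ := by
  rw [mem_commutator_iff_fox N (pow_mem hx m),
    fox_pow _ ((QuotientGroup.eq_one_iff x).2 hx)] at h
  rw [mem_commutator_iff_fox N hx]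
  exact (smul_eq_zero.1 h).resolve_left hm

theorem mem_commutator_of_conj_eq {x : FreeGroup α} (hx : x ∈ N) {g : FreeGroup α}
    (hg : ¬ IsOfFinOrder (g : FreeGroup α ⧸ N)) (h : g * x * g⁻¹ * x⁻¹ ∈ ⁅N, N⁆) :
    x ∈ ⁅N, N⁆ := by
  have hx1 : QuotientGroup.mk' N x = 1 := (QuotientGroup.eq_one_iff x).2 hx
  have hc : g * x * g⁻¹ ∈ N := ‹N.Normal›.conj_mem x hx g
  rw [mem_commutator_iff_fox N (mul_mem hc (inv_mem hx)),
    fox_mul_of_mem_ker _ ((QuotientGroup.eq_one_iff _).2 hc), fox_conj _ _ hx1, fox_inv, hx1,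
    inv_one, translate_one, ← sub_eq_add_neg, sub_eq_zero] at h
  rw [mem_commutator_iff_fox N hx]
  by_contra hne
  obtain ⟨p, hp, hp'⟩ := exists_extremal_of_ne_zero hne hg
  refine hp ?_
  rw [← h, translate_apply]
  simpa using hp' 1 one_pos

end FoxDerivative

/-! ### Covers by fixed point sets. -/

section Cover

theorem exists_prod_eq_mul_of_mem {M : Type u} [Monoid M] {l : List M}
    (hl : ∀ a ∈ l, ∀ b ∈ l, Commute a b) {a : M} (ha : a ∈ l) : ∃ c, l.prod = a * c := by
  induction l with
  | nil => simp at ha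
  | cons b l ih =>
    rcases List.mem_cons.1 ha with rfl | ha
    · exact ⟨l.prod, List.prod_cons⟩
    · obtain ⟨c, hc⟩ := ih (fun x hx y hy => hl x (.tail _ hx) y (.tail _ hy)) ha
      refine ⟨b * c, ?_⟩
      rw [List.prod_cons, hc, ← mul_assoc, (hl b (.head _) a (.tail _ ha)).eq, mul_assoc]

variable {G : Type u} [Group G] (A : Subgroup G) [A.Normal]

open scoped IsMulCommutative in
/-- The endomorphism `a ↦ g a g⁻¹ a⁻¹` of an abelian normal subgroup. -/
def commHom [IsMulCommutative A] (g : G) : Monoid.End A :=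
  MonoidHom.mk' (fun a => MulAut.conjNormal g a * a⁻¹) fun a b => by
    rw [map_mul, mul_inv, mul_mul_mul_comm]

theorem coe_commHom [IsMulCommutative A] (g : G) (a : A) :
    (commHom A g a : G) = g * a * g⁻¹ * (a : G)⁻¹ := rfl

open scoped IsMulCommutative in
theorem commHom_commute [IsMulCommutative A] {g h : G} (hgh : g * h * g⁻¹ * h⁻¹ ∈ A) :
    Commute (commHom A g) (commHom A h) := by
  have key : ∀ a : A, MulAut.conjNormal g (MulAut.conjNormal h a) =
      MulAut.conjNormal h (MulAut.conjNormal g a) := by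
    intro a
    have h1 : (⟨_, hgh⟩ : A) * MulAut.conjNormal h (MulAut.conjNormal g a) * ⟨_, hgh⟩⁻¹ =
        MulAut.conjNormal h (MulAut.conjNormal g a) := by
      rw [mul_comm, inv_mul_cancel_left]
    rw [← h1]
    ext1
    rw [Subgroup.coe_mul, Subgroup.coe_mul, Subgroup.coe_inv]
    simp [mul_assoc]
  refine MonoidHom.ext fun a => ?_
  change MulAut.conjNormal g (MulAut.conjNormal h a * a⁻¹) * (MulAut.conjNormal h a * a⁻¹)⁻¹ =
    MulAut.conjNormal h (MulAut.conjNormal g a * a⁻¹) * (MulAut.conjNormal g a * a⁻¹)⁻¹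
  rw [map_mul, map_mul, map_inv, map_inv, mul_inv, mul_inv, inv_inv, key, mul_assoc, mul_assoc,
    mul_left_comm (MulAut.conjNormal g a)⁻¹]

variable (X : Type v) [MulAction G X]

open scoped IsMulCommutative in
/-- If a `G`-set is covered by the fixed point sets of finitely many elements, then the stabilizer
of every point contains a large part of the abelian normal subgroup `A`. -/
theorem exists_commHom_pow_mem_stabilizer [IsMulCommutative A] (Γ : Finset G)
    (hcover : ∀ x : X, ∃ g ∈ Γ, g • x = x) (x : X) :
    ∃ g ∈ Γ, ∀ a : A, (commHom A g (a ^ (Γ.card).factorial) : G) ∈ MulAction.stabilizer G x := by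
  classical
  let H : G → Subgroup A := fun g =>
    ((MulAction.stabilizer G x).comap A.subtype).comap (commHom A g)
  have hex : ∀ a : A, ∃ g ∈ Γ, (a : G) * g * (a : G)⁻¹ ∈ MulAction.stabilizer G x := by
    intro a
    obtain ⟨g, hg, hgx⟩ := hcover ((a : G)⁻¹ • x)
    refine ⟨g, hg, ?_⟩
    rw [MulAction.mem_stabilizer_iff, mul_smul, mul_smul, hgx, smul_inv_smul]
  choose! b hb using fun (g : G)
    (hg : ∃ a : A, (a : G) * g * (a : G)⁻¹ ∈ MulAction.stabilizer G x) => hg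
  have hcov : ⋃ g ∈ Γ, b g • (H g : Set A) = Set.univ := by
    refine Set.eq_univ_of_forall fun a => ?_
    obtain ⟨g, hg, ha⟩ := hex a
    refine Set.mem_biUnion hg ?_
    rw [Set.mem_smul_set_iff_inv_smul_mem, smul_eq_mul]
    have hbg := hb g ⟨a, ha⟩
    change (commHom A g ((b g)⁻¹ * a) : G) ∈ MulAction.stabilizer G x
    -- Since [g,·] is a homomorphism on A, two conjugates of g in the stabilizer differ by [g,
    -- b⁻¹a]. Hence the a that work for g lie in one coset of `H g`.
    have hcomm : ((b g : G) * g * (b g : G)⁻¹) * ((a : G) * g * (a : G)⁻¹)⁻¹ =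
        commHom A g ((b g)⁻¹ * a) := by
      simp [coe_commHom, mul_assoc]
    rw [← hcomm]
    exact mul_mem hbg (inv_mem ha)
  -- B. H. Neumann's lemma. The index is at most |Γ|, so it divides |Γ|!, an exponent independent of
  -- g and x.
  obtain ⟨g, hg, hfin, hind⟩ := Subgroup.exists_index_le_card_of_leftCoset_cover hcov
  refine ⟨g, hg, fun a => ?_⟩
  obtain ⟨k, hk⟩ := Nat.dvd_factorial (Nat.pos_of_ne_zero hfin.index_ne_zero) hind
  have hmem : a ^ (Γ.card).factorial ∈ H g := by
    rw [hk, pow_mul]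
    have : (H g).Normal := Subgroup.normal_of_isMulCommutative _
    exact pow_mem (Subgroup.pow_index_mem (H g) a) k
  exact hmem

/-- A faithful `G`-set cannot be covered by the fixed point sets of finitely many elements that
commute modulo an abelian normal subgroup `A` and act on it like regular elements of a ring acting
on a torsion-free module, unless `A` is trivial. -/
theorem eq_bot_of_fixedBy_cover [FaithfulSMul G X] (hA : IsMulCommutative A) (Γ : Finset G)
    (hcover : ∀ x : X, ∃ g ∈ Γ, g • x = x) (hcomm : ∀ g ∈ Γ, ∀ h ∈ Γ, g * h * g⁻¹ * h⁻¹ ∈ A)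
    (htf : ∀ a ∈ A, ∀ m : ℕ, m ≠ 0 → a ^ m = 1 → a = 1)
    (hfix : ∀ g ∈ Γ, ∀ a ∈ A, g * a * g⁻¹ * a⁻¹ = 1 → a = 1) : A = ⊥ := by
  rw [Subgroup.eq_bot_iff_forall]
  intro a ha
  have hl : ∀ f ∈ Γ.toList.map (commHom A), ∀ f' ∈ Γ.toList.map (commHom A), Commute f f' := by
    simp only [List.mem_map, Finset.mem_toList]
    rintro _ ⟨g, hg, rfl⟩ _ ⟨h, hh, rfl⟩
    exact commHom_commute A (hcomm g hg h hh)
  have hinj : ∀ l : List G, (∀ g ∈ l, g ∈ Γ) → ∀ c : A, (l.map (commHom A)).prod c = 1 → c = 1 := by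
    intro l
    induction l with
    | nil => intro _ c hc; exact hc
    | cons g l ih =>
      intro hg c hc
      rw [List.map_cons, List.prod_cons] at hc
      refine ih (fun x hx => hg x (.tail _ hx)) c (Subtype.ext ?_)
      exact hfix g (hg g (.head _)) _ (SetLike.coe_mem _) (congrArg Subtype.val hc)
  have htriv : (((Γ.toList.map (commHom A)).prod (⟨a, ha⟩ ^ (Γ.card).factorial) : A) : G) = 1 := by
    refine FaithfulSMul.eq_of_smul_eq_smul (α := X) fun x => ?_
    obtain ⟨g, hg, h⟩ := exists_commHom_pow_mem_stabilizer A X Γ hcover x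
    -- The factor g depends on x; commutativity lets any factor be applied last.
    obtain ⟨f, hf⟩ := exists_prod_eq_mul_of_mem hl
      (List.mem_map_of_mem (f := commHom A) (Finset.mem_toList.2 hg))
    have := h (f ⟨a, ha⟩)
    rw [← map_pow] at this
    rw [hf, one_smul]
    exact this
  have h1 := hinj Γ.toList (fun g hg => Finset.mem_toList.1 hg) _ (Subtype.ext htriv)
  exact htf a ha _ (Nat.factorial_ne_zero _) (congrArg Subtype.val h1)

end Cover

/-! ### Abelian and derived subgroups of free groups. -/

section FreeGroups

/-- Two distinct generators could be sent to non-commuting transpositions. -/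
theorem subsingleton_generators_of_isMulCommutative {G : Type u} [Group G] [IsFreeGroup G]
    [IsMulCommutative G] : Subsingleton (IsFreeGroup.Generators G) := by
  classical
  refine ⟨fun a b => ?_⟩
  by_contra hab
  let f : G →* Equiv.Perm (Fin 3) := IsFreeGroup.lift fun i =>
    if i = a then Equiv.swap 0 1 else Equiv.swap 1 2
  have h := congrArg f (mul_comm' (IsFreeGroup.of a) (IsFreeGroup.of b))
  rw [map_mul, map_mul, IsFreeGroup.lift_of, IsFreeGroup.lift_of, if_pos rfl,
    if_neg (Ne.symm hab)] at h
  revert h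
  decide

theorem isCyclic_of_isMulCommutative {G : Type u} [Group G] [IsFreeGroup G]
    [IsMulCommutative G] : IsCyclic G := by
  have := subsingleton_generators_of_isMulCommutative (G := G)
  rw [(IsFreeGroup.toFreeGroup G).isCyclic]
  cases isEmpty_or_nonempty (IsFreeGroup.Generators G)
  · infer_instance
  · have : Unique (IsFreeGroup.Generators G) := uniqueOfSubsingleton (Classical.arbitrary _)
    infer_instance

/-- By Nielsen–Schreier N is free; sending all its generators to 1 ∈ ℤ kills N' but no generator. -/
theorem eq_bot_of_le_commutator {G : Type u} [Group G] [IsFreeGroup G] {N : Subgroup G}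
    (h : N ≤ ⁅N, N⁆) : N = ⊥ := by
  have hemp : IsEmpty (IsFreeGroup.Generators N) := by
    refine ⟨fun a => ?_⟩
    let f : N →* Multiplicative ℤ := IsFreeGroup.lift fun _ => Multiplicative.ofAdd 1
    have ha : ((IsFreeGroup.of a : N) : G) ∈ ⁅N, N⁆ := h (SetLike.coe_mem _)
    rw [← Subgroup.map_subtype_commutator] at ha
    obtain ⟨y, hy, hya⟩ := ha
    have hy' : y = IsFreeGroup.of a := Subtype.ext hya
    subst hy'
    have := Abelianization.commutator_subset_ker f hy
    rw [MonoidHom.mem_ker, IsFreeGroup.lift_of] at this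
    exact absurd this (by decide)
  have := (IsFreeGroup.toFreeGroup N).toEquiv.subsingleton
  exact Subgroup.eq_bot_of_subsingleton N

/-- A 5-cycle and an adjacent transposition generate the non-solvable group S₅. -/
theorem derivedSeries_freeGroup_ne_bot {d : ℕ} (hd : 2 ≤ d) (k : ℕ) :
    derivedSeries (FreeGroup (Fin d)) k ≠ ⊥ := by
  intro h
  let f : FreeGroup (Fin d) →* Equiv.Perm (Fin 5) := FreeGroup.lift fun i =>
    if (i : ℕ) = 0 then finRotate 5 else Equiv.swap 0 (finRotate 5 0)
  have hf : Function.Surjective f := by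
    rw [← MonoidHom.range_eq_top, eq_top_iff,
      ← Equiv.Perm.closure_cycle_adjacent_swap (isCycle_finRotate (n := 3))
        (support_finRotate (n := 3)) 0, Subgroup.closure_le]
    rintro _ (rfl | rfl)
    · exact ⟨FreeGroup.of ⟨0, by omega⟩, by simp [f]⟩
    · exact ⟨FreeGroup.of ⟨1, by omega⟩, by simp [f]⟩
  have : Group.IsSolvable (FreeGroup (Fin d)) := ⟨k, h⟩
  exact Equiv.Perm.not_isSolvable_fin_5 (Group.isSolvable_of_surjective hf)

theorem not_derivedSeries_le_succ {d : ℕ} (hd : 2 ≤ d) (k : ℕ) :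
    ¬ derivedSeries (FreeGroup (Fin d)) k ≤ derivedSeries (FreeGroup (Fin d)) (k + 1) :=
  fun h => derivedSeries_freeGroup_ne_bot hd k (eq_bot_of_le_commutator h)

theorem not_isOfFinOrder_of {d : ℕ} (i : Fin d) {M : Subgroup (FreeGroup (Fin d))} [M.Normal]
    (hM : M ≤ commutator (FreeGroup (Fin d))) :
    ¬ IsOfFinOrder (FreeGroup.of i : FreeGroup (Fin d) ⧸ M) := by
  let f : FreeGroup (Fin d) →* Multiplicative ℤ := FreeGroup.lift fun _ => Multiplicative.ofAdd 1
  have hf : M ≤ f.ker := hM.trans (Abelianization.commutator_subset_ker f)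
  intro h
  have h1 := (QuotientGroup.lift M f hf).isOfFinOrder h
  rw [QuotientGroup.lift_mk, isOfFinOrder_iff_eq_one] at h1
  simp [f] at h1

end FreeGroups

/-! ### Word balls and growth. -/

section WordMetric

variable {G : Type u} [Group G]

theorem wordBall_add (S : Set G) (m n : ℕ) : wordBall S (m + n) = wordBall S m * wordBall S n :=
  pow_add _ _ _

theorem wordBall_mul (S : Set G) (m n : ℕ) : wordBall S (m * n) = wordBall S m ^ n :=
  pow_mul _ _ _

theorem one_mem_wordBall (S : Set G) (n : ℕ) : (1 : G) ∈ wordBall S n :=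
  Set.one_mem_pow (Set.mem_insert _ _)

theorem wordBall_mono (S : Set G) : Monotone (wordBall S) :=
  fun _ _ h => Set.pow_subset_pow_right (Set.mem_insert _ _) h

theorem wordBall_inv (S : Set G) (n : ℕ) : (wordBall S n)⁻¹ = wordBall S n := by
  rw [wordBall, ← inv_pow, Set.inv_insert, Set.union_inv, inv_inv, inv_one, Set.union_comm]

theorem exists_mem_wordBall {S : Set G} (hS : Subgroup.closure S = ⊤) (g : G) :
    ∃ n, g ∈ wordBall S n := by
  have hg : g ∈ Subgroup.closure S := hS ▸ Subgroup.mem_top g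
  induction hg using Subgroup.closure_induction with
  | mem x hx => exact ⟨1, by rw [wordBall, pow_one]; exact .inr (.inl hx)⟩
  | one => exact ⟨0, one_mem_wordBall S 0⟩
  | mul x y _ _ hx hy =>
    obtain ⟨m, hm⟩ := hx
    obtain ⟨n, hn⟩ := hy
    exact ⟨m + n, wordBall_add S m n ▸ Set.mul_mem_mul hm hn⟩
  | inv x _ hx =>
    obtain ⟨m, hm⟩ := hx
    exact ⟨m, by rw [← wordBall_inv]; exact Set.inv_mem_inv.2 hm⟩

theorem exists_subset_wordBall {S : Set G} (hS : Subgroup.closure S = ⊤) {B : Set G}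
    (hB : B.Finite) : ∃ n, B ⊆ wordBall S n := by
  choose f hf using exists_mem_wordBall hS
  obtain ⟨n, hn⟩ := (hB.image f).bddAbove
  exact ⟨n, fun b hb => wordBall_mono S (hn (Set.mem_image_of_mem f hb)) (hf b)⟩

/-- A surjective homomorphism maps balls onto balls, up to rescaling. -/
theorem exists_wordBall_subset_image {Q : Type w} [Group Q] {π : G →* Q}
    (hπ : Function.Surjective π) {S : Set G} (hS : Subgroup.closure S = ⊤) {T : Set Q}
    (hT : T.Finite) : ∃ C, 0 < C ∧ ∀ n, wordBall T n ⊆ π '' wordBall S (C * n) := by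
  choose s hs using hπ
  obtain ⟨C, hC⟩ := exists_subset_wordBall hS ((wordBall_finite hT 1).image s)
  refine ⟨C + 1, C.succ_pos, fun n => ?_⟩
  rw [wordBall_mul, Set.image_pow, wordBall]
  refine Set.pow_subset_pow_left fun q hq => ⟨s q, wordBall_mono S C.le_succ (hC ?_), hs q⟩
  exact Set.mem_image_of_mem s (by rwa [wordBall, pow_one])

theorem ncard_le_vol {S : Set G} (hS : S.Finite) {X : Type v} [MulAction G X] {n : ℕ}
    {F : Set G} (hF : F ⊆ wordBall S n) {x : X} (hx : Set.InjOn (fun g : G => g • x) F) :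
    F.ncard ≤ vol S X n := by
  refine le_trans ?_ (le_ciSup (bddAbove_vol hS X n) x)
  rw [← hx.ncard_image]
  exact Set.ncard_le_ncard (Set.image_mono hF) ((wordBall_finite hS n).image _)

theorem ncard_le_relVol {S : Set G} (hS : S.Finite) (L : Subgroup G) {n : ℕ}
    {F : Set G} (hF : F ⊆ wordBall S n) (hL : F ⊆ L) : F.ncard ≤ relVol S (L : Set G) n := by
  refine le_trans ?_ (le_ciSup (bddAbove_relVol hS (L : Set G) n) ⟨1, one_mem L⟩)
  refine Set.ncard_le_ncard (fun g hg => ⟨hL hg, ?_⟩) ?_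
  · simpa using hF hg
  · exact (wordBall_finite hS n).subset fun g hg => by simpa using hg.2

/-- Right translation by an element of the subgroup moves every ball's centre to 1. -/
theorem relVol_le_ncard {S : Set G} (hS : S.Finite) (L : Subgroup G) (n : ℕ) :
    relVol S (L : Set G) n ≤ ((L : Set G) ∩ wordBall S n).ncard := by
  have : Nonempty (L : Set G) := ⟨⟨1, one_mem L⟩⟩
  refine ciSup_le fun h => ?_
  refine Set.ncard_le_ncard_of_injOn (fun g => g * (h : G)⁻¹)
    (fun g hg => ⟨mul_mem hg.1 (inv_mem h.2), hg.2⟩) (fun a _ b _ hab => mul_right_cancel hab)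
    ((wordBall_finite hS n).subset Set.inter_subset_right)

end WordMetric

/-! ### Non-foldability in F/N'. -/

section HigmanExtension

variable {d : ℕ} (N : Subgroup (FreeGroup (Fin d))) [N.Normal]

theorem HigmanExtension.ker_proj :
    (HigmanExtension.proj d N).ker = N.map (QuotientGroup.mk' ⁅N, N⁆) :=
  QuotientGroup.ker_map _ _ _ _

theorem isMulCommutative_map_mk {α : Type u} (N : Subgroup (FreeGroup α)) [N.Normal] :
    IsMulCommutative (N.map (QuotientGroup.mk' ⁅N, N⁆)) := by
  refine ⟨⟨?_⟩⟩
  rintro ⟨_, a, ha, rfl⟩ ⟨_, b, hb, rfl⟩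
  refine Subtype.ext ?_
  change ((a * b : FreeGroup α) : FreeGroup α ⧸ ⁅N, N⁆) = ((b * a : FreeGroup α) : _)
  rw [eq_comm, QuotientGroup.eq]
  have h := Subgroup.commutator_mem_commutator (inv_mem ha) (inv_mem hb)
  rw [commutatorElement_def] at h
  simpa [mul_assoc] using h

variable {N}

/-- If `N` is trivial, then a faithful action is not covered by the fixed point sets of finitely many
elements of infinite order of an abelian subgroup. -/
theorem not_fixedBy_cover_of_eq_bot (hN : N = ⊥) {L : Subgroup (FreeGroup (Fin d) ⧸ N)}
    (hL : ∀ a ∈ L, ∀ b ∈ L, a * b = b * a) {X : Type v} [MulAction (HigmanExtension d N) X]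
    [FaithfulSMul (HigmanExtension d N) X] [Nonempty X] (Γ : Finset (HigmanExtension d N))
    (hΓ : ∀ g ∈ Γ, HigmanExtension.proj d N g ∈ L ∧
      ¬ IsOfFinOrder (HigmanExtension.proj d N g)) :
    ¬ ∀ x : X, ∃ g ∈ Γ, g • x = x := by
  intro hcover
  let K : Subgroup (FreeGroup (Fin d)) := L.comap (QuotientGroup.mk' N)
  have : IsMulCommutative K := by
    refine ⟨⟨?_⟩⟩
    rintro ⟨a, ha⟩ ⟨b, hb⟩
    have h := hL _ ha _ hb
    rw [← map_mul, ← map_mul] at h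
    have hinj : Function.Injective (QuotientGroup.mk' N) := by
      rw [← MonoidHom.ker_eq_bot_iff, QuotientGroup.ker_mk', hN]
    exact Subtype.ext (hinj h)
  obtain ⟨⟨z, hz⟩, hgen⟩ := isCyclic_of_isMulCommutative (G := K)
  have hpow : ∀ g ∈ Γ, ∃ k : ℤ, ((z ^ k : FreeGroup (Fin d)) : HigmanExtension d N) = g := by
    intro g hg
    obtain ⟨w, rfl⟩ := QuotientGroup.mk_surjective g
    obtain ⟨k, hk⟩ := hgen ⟨w, (hΓ _ hg).1⟩
    exact ⟨k, congrArg _ (congrArg Subtype.val hk)⟩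
  choose! k hk using hpow
  have hz1 : ¬ IsOfFinOrder z := by
    intro hz1
    obtain ⟨g, hg, -⟩ := hcover (Classical.arbitrary X)
    refine (hΓ g hg).2 (MonoidHom.isOfFinOrder _ ?_)
    rw [← hk g hg]
    exact (QuotientGroup.mk' ⁅N, N⁆).isOfFinOrder hz1.zpow
  -- The product of the exponents makes one power of z a power of every g ∈ Γ, so it fixes every
  -- point.
  have hk0 : ∏ g ∈ Γ, k g ≠ 0 := by
    refine Finset.prod_ne_zero_iff.2 fun g hg h0 => (hΓ g hg).2 ?_
    rw [← hk g hg, h0, zpow_zero, QuotientGroup.mk_one, map_one]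
    exact IsOfFinOrder.one
  have htriv : ((z ^ (∏ g ∈ Γ, k g) : FreeGroup (Fin d)) : HigmanExtension d N) = 1 := by
    refine FaithfulSMul.eq_of_smul_eq_smul (α := X) fun x => ?_
    obtain ⟨g, hg, hgx⟩ := hcover x
    obtain ⟨c, hc⟩ := Finset.dvd_prod_of_mem k hg
    rw [one_smul, hc, zpow_mul, QuotientGroup.mk_zpow, hk g hg]
    exact (MulAction.stabilizer (HigmanExtension d N) x).zpow_mem hgx c
  rw [QuotientGroup.eq_one_iff] at htriv
  exact hz1 (isOfFinOrder_iff_zpow_eq_one.2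
    ⟨_, hk0, Subgroup.mem_bot.1 (hN.le (Subgroup.commutator_le_left N N htriv))⟩)

/-- Lifts of torsion-free abelian subgroups of `F / N` to `F / N'` are non-foldable. -/
theorem isNonFoldable_of_isLift {L : Subgroup (FreeGroup (Fin d) ⧸ N)}
    (hL : IsTorsionFreeAbelian L) {L' : Set (HigmanExtension d N)}
    (hL' : IsLift (HigmanExtension.proj d N) L' (L : Set (FreeGroup (Fin d) ⧸ N))) :
    IsNonFoldable.{0, v} L' := by
  classical
  intro X _ _ _ F hF
  by_contra! hfold
  let Γ : Finset (HigmanExtension d N) :=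
    ((F ×ˢ F).filter fun p => p.1 ≠ p.2).image fun p => p.1⁻¹ * p.2
  have hΓ : ∀ g ∈ Γ, HigmanExtension.proj d N g ∈ L ∧
      ¬ IsOfFinOrder (HigmanExtension.proj d N g) := by
    intro g hg
    simp only [Γ, Finset.mem_image, Finset.mem_filter, Finset.mem_product, Prod.exists] at hg
    obtain ⟨a, b, ⟨⟨ha, hb⟩, hab⟩, rfl⟩ := hg
    have hmem : HigmanExtension.proj d N (a⁻¹ * b) ∈ L := by
      rw [map_mul, map_inv]
      exact mul_mem (inv_mem (hL'.mapsTo (hF ha))) (hL'.mapsTo (hF hb))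
    refine ⟨hmem, fun hfin => hab (hL'.injOn (hF ha) (hF hb) ?_)⟩
    have h1 := hL.2 _ hmem hfin
    rwa [map_mul, map_inv, inv_mul_eq_one] at h1
  have hcover : ∀ x : X, ∃ g ∈ Γ, g • x = x := by
    intro x
    have hx := hfold x
    simp only [Set.InjOn] at hx
    push Not at hx
    obtain ⟨a, ha, b, hb, hab, hne⟩ := hx
    refine ⟨a⁻¹ * b, Finset.mem_image.2 ⟨(a, b), by simpa using ⟨⟨ha, hb⟩, hne⟩, rfl⟩, ?_⟩
    rw [mul_smul, ← hab, inv_smul_smul]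
  -- When N = N' the group A is trivial and the cover argument is void; then N = 1.
  by_cases hN : N ≤ ⁅N, N⁆
  · exact not_fixedBy_cover_of_eq_bot (eq_bot_of_le_commutator hN) hL.1 Γ hΓ hcover
  have hAn : (N.map (QuotientGroup.mk' ⁅N, N⁆)).Normal :=
    Subgroup.Normal.map ‹_› _ (QuotientGroup.mk'_surjective _)
  refine hN ?_
  have hA := eq_bot_of_fixedBy_cover (N.map (QuotientGroup.mk' ⁅N, N⁆)) X
    (isMulCommutative_map_mk N) Γ hcover ?_ ?_ ?_
  · rwa [Subgroup.map_eq_bot_iff, QuotientGroup.ker_mk'] at hA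
  · intro g hg h hh
    rw [← HigmanExtension.ker_proj, MonoidHom.mem_ker, map_mul, map_mul, map_mul, map_inv, map_inv,
      hL.1 _ (hΓ g hg).1 _ (hΓ h hh).1]
    simp
  · rintro _ ⟨x, hx, rfl⟩ m hm h
    rw [← map_pow] at h
    exact (QuotientGroup.eq_one_iff _).2
      (mem_commutator_of_pow_mem N hx hm ((QuotientGroup.eq_one_iff _).1 h))
  · rintro g hg _ ⟨x, hx, rfl⟩ h
    obtain ⟨w, rfl⟩ := QuotientGroup.mk_surjective g
    exact (QuotientGroup.eq_one_iff _).2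
      (mem_commutator_of_conj_eq N hx (hΓ _ hg).2 ((QuotientGroup.eq_one_iff _).1 h))

theorem HigmanExtension.proj_surjective : Function.Surjective (HigmanExtension.proj d N) := by
  intro q
  obtain ⟨w, rfl⟩ := QuotientGroup.mk_surjective q
  exact ⟨(w : HigmanExtension d N), rfl⟩

/-- The growth of a faithful action of `F / N'` dominates the relative growth of every torsion-free
abelian subgroup of `F / N`. -/
theorem growthLE_relVol_vol {L : Subgroup (FreeGroup (Fin d) ⧸ N)}
    (hL : IsTorsionFreeAbelian L) (X : Type v) [MulAction (HigmanExtension d N) X]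
    [FaithfulSMul (HigmanExtension d N) X] [Nonempty X] {S : Set (HigmanExtension d N)}
    {T : Set (FreeGroup (Fin d) ⧸ N)} (hS : IsFiniteGenSet S) (hT : T.Finite) :
    GrowthLE (fun n => (relVol T (L : Set (FreeGroup (Fin d) ⧸ N)) n : ℝ))
      (fun n => (vol S X n : ℝ)) := by
  classical
  obtain ⟨C, hC, hball⟩ := exists_wordBall_subset_image
    (HigmanExtension.proj_surjective (N := N)) hS.2 hT
  refine ⟨C, hC, fun n => ?_⟩
  -- The lift depends on n and is short only over the n-ball; this suffices because every lift is
  -- non-foldable.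
  have hlift : ∀ q, ∃ g, HigmanExtension.proj d N g = q ∧
      (q ∈ wordBall T n → g ∈ wordBall S (C * n)) := by
    intro q
    by_cases hq : q ∈ wordBall T n
    · obtain ⟨g, hg, rfl⟩ := hball n hq
      exact ⟨g, rfl, fun _ => hg⟩
    · obtain ⟨g, hg⟩ := HigmanExtension.proj_surjective q
      exact ⟨g, hg, fun h => absurd h hq⟩
  choose s hs hsball using hlift
  have hsL : IsLift (HigmanExtension.proj d N) (s '' L) (L : Set (FreeGroup (Fin d) ⧸ N)) := by
    refine ⟨?_, ?_, fun q hq => ⟨s q, ⟨q, hq, rfl⟩, hs q⟩⟩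
    · rintro _ ⟨q, hq, rfl⟩
      rwa [hs]
    · rintro _ ⟨q, hq, rfl⟩ _ ⟨r, hr, rfl⟩ h
      rw [hs, hs] at h
      rw [h]
  have hfin : ((L : Set (FreeGroup (Fin d) ⧸ N)) ∩ wordBall T n).Finite :=
    (wordBall_finite hT n).subset Set.inter_subset_right
  obtain ⟨x, hx⟩ := isNonFoldable_of_isLift.{v} hL hsL X (hfin.image s).toFinset
    (by rw [Set.Finite.coe_toFinset]; exact Set.image_mono Set.inter_subset_left)
  rw [Set.Finite.coe_toFinset] at hx
  have h1 : (s '' ((L : Set (FreeGroup (Fin d) ⧸ N)) ∩ wordBall T n)).ncard ≤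
      vol S X (C * n) := by
    refine ncard_le_vol hS.1 ?_ hx
    rintro _ ⟨q, hq, rfl⟩
    exact hsball q hq.2
  rw [Set.ncard_image_of_injective _ (Function.LeftInverse.injective hs)] at h1
  have h2 : relVol T (L : Set (FreeGroup (Fin d) ⧸ N)) n ≤ C * vol S X (C * n) :=
    ((relVol_le_ncard hT L n).trans h1).trans (Nat.le_mul_of_pos_left _ hC)
  dsimp only
  exact_mod_cast h2

end HigmanExtension

/-! ### Exponential relative growth of M/M'. -/

section ExponentialGrowth

variable {α : Type u} (M : Subgroup (FreeGroup α)) [M.Normal]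

theorem isTorsionFreeAbelian_map_mk :
    IsTorsionFreeAbelian (M.map (QuotientGroup.mk' ⁅M, M⁆)) := by
  refine ⟨fun a ha b hb => congrArg Subtype.val
    ((isMulCommutative_map_mk M).is_comm.comm ⟨a, ha⟩ ⟨b, hb⟩), ?_⟩
  rintro _ ⟨x, hx, rfl⟩ h
  obtain ⟨m, hm, h⟩ := isOfFinOrder_iff_pow_eq_one.1 h
  rw [← map_pow] at h
  exact (QuotientGroup.eq_one_iff _).2
    (mem_commutator_of_pow_mem M hx hm.ne' ((QuotientGroup.eq_one_iff _).1 h))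

/-- The word obtained by inserting `x` or not before each occurrence of `g` in a power of `g`. -/
def lamplighterWord {G : Type u} [Group G] (g x : G) : List Bool → G
  | [] => 1
  | b :: l => cond b x 1 * g * lamplighterWord g x l

theorem map_lamplighterWord {G : Type u} {H : Type w} [Group G] [Group H] (f : G →* H) (g x : G)
    (l : List Bool) : f (lamplighterWord g x l) = lamplighterWord (f g) (f x) l := by
  induction l with
  | nil => exact map_one f
  | cons b l ih => cases b <;> simp [lamplighterWord, ih]

theorem lamplighterWord_one {G : Type u} [Group G] (g : G) (l : List Bool) :
    lamplighterWord g 1 l = g ^ l.length := by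
  induction l with
  | nil => exact (pow_zero g).symm
  | cons b l ih => cases b <;> simp [lamplighterWord, ih, pow_succ']

theorem lamplighterWord_mem_wordBall {G : Type u} [Group G] {S : Set G} {c : ℕ} {g x : G}
    (hg : g ∈ wordBall S c) (hx : x ∈ wordBall S c) (l : List Bool) :
    lamplighterWord g x l ∈ wordBall S (2 * c * l.length) := by
  induction l with
  | nil => exact one_mem_wordBall S _
  | cons b l ih =>
    have hb : cond b x 1 ∈ wordBall S c := by
      cases b
      · exact one_mem_wordBall S c
      · exact hx
    have : 2 * c * (b :: l).length = c + c + 2 * c * l.length := by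
      rw [List.length_cons]; ring
    rw [this, wordBall_add, wordBall_add]
    exact Set.mul_mem_mul (Set.mul_mem_mul hb hg) ih

theorem fox_lamplighterWord_cons {x : FreeGroup α} (hx : x ∈ M) (g : FreeGroup α) (b : Bool)
    (l : List Bool) :
    fox (QuotientGroup.mk' M) (lamplighterWord g x (b :: l)) =
      (cond b 1 0 : ℤ) • fox (QuotientGroup.mk' M) x + fox (QuotientGroup.mk' M) g +
        translate (g : FreeGroup α ⧸ M)
          (fox (QuotientGroup.mk' M) (lamplighterWord g x l)) := by
  have hx1 : QuotientGroup.mk' M x = 1 := (QuotientGroup.eq_one_iff x).2 hx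
  rw [lamplighterWord, fox_mul, fox_mul]
  cases b
  · simp [translate_one]
  · rw [cond_true, cond_true, map_mul, hx1, translate_one, one_mul, one_smul]
    rfl

/-- The derivative is the sum of εᵢ gⁱ·fox(x), with εᵢ the digits, plus a term depending only on the
length. At the extremal point p only the first digit is visible; cancel it and induct. -/
theorem fox_lamplighterWord_injective {x : FreeGroup α} (hx : x ∈ M) (hx' : x ∉ ⁅M, M⁆)
    {g : FreeGroup α} (hg : ¬ IsOfFinOrder (g : FreeGroup α ⧸ M)) {l l' : List Bool}
    (hl : l.length = l'.length)
    (h : fox (QuotientGroup.mk' M) (lamplighterWord g x l) =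
      fox (QuotientGroup.mk' M) (lamplighterWord g x l')) : l = l' := by
  rw [mem_commutator_iff_fox M hx] at hx'
  obtain ⟨p, hp, hp'⟩ := exists_extremal_of_ne_zero hx' hg
  -- Beyond p, at g⁻ʲp, no digit is visible.
  have hzero : ∀ l l' : List Bool, l.length = l'.length → ∀ j : ℕ, 0 < j →
      fox (QuotientGroup.mk' M) (lamplighterWord g x l) (((g : FreeGroup α ⧸ M) ^ j)⁻¹ * p.1, p.2)
        = fox (QuotientGroup.mk' M) (lamplighterWord g x l')
          (((g : FreeGroup α ⧸ M) ^ j)⁻¹ * p.1, p.2) := by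
    intro l
    induction l with
    | nil =>
      intro l' hl
      rw [List.length_eq_zero_iff.1 hl.symm]
      exact fun _ _ => rfl
    | cons b l ih =>
      intro l' hl j hj
      cases l' with
      | nil => simp at hl
      | cons b' l' =>
        have h1 := ih l' (by simpa using hl) (j + 1) j.succ_pos
        rw [pow_succ, mul_inv_rev, mul_assoc] at h1
        rw [fox_lamplighterWord_cons M hx, fox_lamplighterWord_cons M hx]
        simp only [Finsupp.add_apply, Finsupp.smul_apply, translate_apply, hp' j hj, h1]
        simp
  induction l generalizing l' with
  | nil => exact (List.length_eq_zero_iff.1 hl.symm).symm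
  | cons b l ih =>
    cases l' with
    | nil => simp at hl
    | cons b' l' =>
      have hl' : l.length = l'.length := by simpa using hl
      rw [fox_lamplighterWord_cons M hx, fox_lamplighterWord_cons M hx] at h
      have hb : b = b' := by
        have h1 := DFunLike.congr_fun h p
        have h2 := hzero l l' hl' 1 one_pos
        rw [pow_one] at h2
        simp only [Finsupp.add_apply, Finsupp.smul_apply, translate_apply, h2,
          add_left_inj] at h1
        cases b <;> cases b' <;> simp_all
      subst hb
      rw [add_right_inj, EmbeddingLike.apply_eq_iff_eq] at h
      rw [ih hl' h]

/-- The subgroup `M / M'` of `F / M'` has exponential relative growth, provided that it is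
nontrivial and that `F / M` is not a torsion group. -/
theorem exists_two_pow_le_relVol (hM : ¬ M ≤ ⁅M, M⁆) {g : FreeGroup α}
    (hg : ¬ IsOfFinOrder (g : FreeGroup α ⧸ M)) {T : Set (FreeGroup α ⧸ ⁅M, M⁆)}
    (hT : IsFiniteGenSet T) :
    ∃ K : ℕ, 0 < K ∧ ∀ m : ℕ,
      2 ^ m ≤ relVol T (M.map (QuotientGroup.mk' ⁅M, M⁆) : Set (FreeGroup α ⧸ ⁅M, M⁆))
        (K * m) := by
  obtain ⟨x, hx, hx'⟩ := SetLike.not_le_iff_exists.1 hM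
  let π := QuotientGroup.mk' ⁅M, M⁆
  obtain ⟨c, hc⟩ := exists_subset_wordBall hT.2 (B := {π g, π x}) (by simp)
  replace hc := hc.trans (wordBall_mono T (le_max_left c 1))
  have hc0 : 0 < max c 1 := by positivity
  generalize max c 1 = c at hc hc0
  have hcg : π g ∈ wordBall T c := hc (by simp)
  have hcx : π x ∈ wordBall T c := hc (by simp)
  -- The word costs 2cm, and the factor g⁻ᵐ that brings it into M costs cm.
  refine ⟨3 * c, by positivity, fun m => ?_⟩
  let f : List.Vector Bool m → FreeGroup α ⧸ ⁅M, M⁆ := fun l =>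
    π (lamplighterWord g x l.1 * (g ^ m)⁻¹)
  have hf : Function.Injective f := by
    intro l l' h
    refine Subtype.ext (fox_lamplighterWord_injective M hx hx' hg (l.2.trans l'.2.symm) ?_)
    simp only [f, map_mul, mul_left_inj] at h
    rw [QuotientGroup.mk'_apply, QuotientGroup.mk'_apply, QuotientGroup.eq] at h
    rw [← mul_inv_cancel_left (lamplighterWord g x l.1) (lamplighterWord g x l'.1), fox_mul,
      (mem_commutator_iff_fox M (Subgroup.commutator_le_left M M h)).1 h, map_zero, add_zero]
  have hcard : (Set.range f).ncard = 2 ^ m := by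
    rw [← Set.image_univ, Set.ncard_image_of_injective _ hf, Set.ncard_univ, Nat.card_eq_fintype_card,
      card_vector, Fintype.card_bool]
  rw [← hcard]
  refine ncard_le_relVol hT.1 _ ?_ ?_
  · rintro _ ⟨l, rfl⟩
    have h1 := lamplighterWord_mem_wordBall hcg hcx l.1
    rw [l.2] at h1
    have h2 : (π g ^ m)⁻¹ ∈ wordBall T (c * m) := by
      rw [← wordBall_inv, wordBall_mul]
      exact Set.inv_mem_inv.2 (Set.pow_mem_pow hcg)
    have : 3 * c * m = 2 * c * m + c * m := by ring
    rw [this, wordBall_add]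
    simp only [f]
    rw [map_mul, map_inv, map_pow, map_lamplighterWord]
    exact Set.mul_mem_mul h1 h2
  · rintro _ ⟨l, rfl⟩
    refine ⟨_, ?_, rfl⟩
    rw [SetLike.mem_coe, ← QuotientGroup.ker_mk' M, MonoidHom.mem_ker, map_mul, map_lamplighterWord,
      show QuotientGroup.mk' M x = 1 from (QuotientGroup.eq_one_iff x).2 hx,
      lamplighterWord_one, l.2, map_inv, map_pow, mul_inv_cancel]

end ExponentialGrowth

/-- If `M` is a nontrivial normal subgroup of `F` contained in `[F, F]`, then `F / M''` has an
exponential Schreier growth gap. -/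
theorem hasSchreierGrowthGap_exp {d : ℕ} (hd : 0 < d) {M : Subgroup (FreeGroup (Fin d))}
    [M.Normal] (hM : ¬ M ≤ ⁅M, M⁆) (hM' : M ≤ commutator (FreeGroup (Fin d))) :
    HasSchreierGrowthGap.{0, v} (HigmanExtension d ⁅M, M⁆) (fun n => Real.exp n) := by
  refine ⟨Group.fg_of_surjective (QuotientGroup.mk'_surjective _), ?_⟩
  intro X _ _ _ S hS
  have hfg : Group.FG (FreeGroup (Fin d) ⧸ ⁅M, M⁆) :=
    Group.fg_of_surjective (QuotientGroup.mk'_surjective _)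
  obtain ⟨T, hT, hTfin⟩ := Group.fg_iff.1 hfg
  obtain ⟨K, hK0, hK⟩ := exists_two_pow_le_relVol M hM (not_isOfFinOrder_of ⟨0, hd⟩ hM')
    ⟨hTfin, hT⟩
  obtain ⟨C, hC, hvol⟩ := growthLE_relVol_vol (isTorsionFreeAbelian_map_mk M) X hS hTfin
  -- The factor 2 comes from eⁿ ≤ 4ⁿ = 2²ⁿ.
  refine ⟨C * (2 * K), by positivity, fun n => ?_⟩
  have hexp : Real.exp n ≤ 2 ^ (2 * n) := by
    rw [← Real.exp_one_pow, pow_mul]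
    exact pow_le_pow_left₀ (Real.exp_pos 1).le (by linarith [Real.exp_one_lt_three]) n
  have h1 : (2 : ℝ) ^ (2 * n) ≤ C * vol S X (C * (K * (2 * n))) :=
    le_trans (by dsimp only; exact_mod_cast hK (2 * n)) (hvol (K * (2 * n)))
  have h2 : C * (2 * K) * n = C * (K * (2 * n)) := by ring
  dsimp only
  rw [h2]
  refine (hexp.trans h1).trans (mul_le_mul_of_nonneg_right ?_ (Nat.cast_nonneg _))
  exact_mod_cast Nat.le_mul_of_pos_right C (by positivity)

/-- With M = F^(j+1), M'' is F^(j+3) by definition. Length at least 3 ensures M ≤ [F,F], so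
generators have infinite order in F/M. -/
theorem hasSchreierGrowthGap_freeSolvableGroup {d : ℕ} (hd : 2 ≤ d) (j : ℕ) :
    HasSchreierGrowthGap.{0, v} (FreeSolvableGroup d (j + 3)) (fun n => Real.exp n) :=
  hasSchreierGrowthGap_exp (M := derivedSeries (FreeGroup (Fin d)) (j + 1)) (by omega)
    (not_derivedSeries_le_succ hd (j + 1))
    ((derivedSeries_antitone _ (Nat.le_add_left 1 j)).trans_eq (derivedSeries_one _))

end SchreierGrowth

theorem mainTheorem12 :
    -- the free solvable group of rank at least 2 and length at least 3 has an exponential gap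
    (∀ d l : ℕ, 2 ≤ d → 3 ≤ l →
      SchreierGrowth.HasSchreierGrowthGap.{0, v} (SchreierGrowth.FreeSolvableGroup d l)
        (fun n => Real.exp n)) ∧
    -- lifts of torsion-free abelian subgroups in Higman type extensions
    (∀ (d : ℕ) (N : Subgroup (FreeGroup (Fin d))) [N.Normal] (L : Subgroup (FreeGroup (Fin d) ⧸ N)),
      SchreierGrowth.IsTorsionFreeAbelian L →
        (∀ L' : Set (SchreierGrowth.HigmanExtension d N),
          SchreierGrowth.IsLift (SchreierGrowth.HigmanExtension.proj d N) L'
            (L : Set (FreeGroup (Fin d) ⧸ N)) →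
          SchreierGrowth.IsNonFoldable.{0, v} L') ∧
        (∀ (X : Type v) [MulAction (SchreierGrowth.HigmanExtension d N) X]
          [FaithfulSMul (SchreierGrowth.HigmanExtension d N) X] [Nonempty X]
          (S : Set (SchreierGrowth.HigmanExtension d N)) (T : Set (FreeGroup (Fin d) ⧸ N)),
          SchreierGrowth.IsFiniteGenSet S → SchreierGrowth.IsFiniteGenSet T →
          SchreierGrowth.GrowthLE
            (fun n => (SchreierGrowth.relVol T (L : Set (FreeGroup (Fin d) ⧸ N)) n : ℝ))
            (fun n => (SchreierGrowth.vol S X n : ℝ)))) := by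
  refine ⟨fun d l hd hl => ?_, fun d N _ L hL => ⟨fun L' hL' => ?_, ?_⟩⟩
  · obtain ⟨j, rfl⟩ := Nat.exists_eq_add_of_le' hl
    exact SchreierGrowth.hasSchreierGrowthGap_freeSolvableGroup hd j
  · exact SchreierGrowth.isNonFoldable_of_isLift hL hL'
  · intro X _ _ _ S T hS hT
    exact SchreierGrowth.growthLE_relVol_vol hL X hS hT.1
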